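/- Let $k,m\ge 1$ and identify $M_k\otimes M_m\simeq M_{km}$ (complex matrices) via the Kronecker product. Let $B=\sum_{i=1}^n C_i\otimes D_i\in M_k\otimes M_m$ be PPT, i.e. $B$ and its partial transposition $B^{t_2}=\sum_{i=1}^n C_i\otimes D_i^t$ are positive semidefinite Hermitian matrices. Identify $M_m\otimes M_k\simeq M_{mk}$ and define $$\widetilde B=\sum_{i=1}^n (Id_m\otimes C_i)\otimes (D_i\otimes Id_k)\in M_{mk}\otimes M_{mk}.$$ Definitions. A matrix $A\in M_p\otimes M_q$ can be put in the filter normal form if there are invertible $R\in M_p$, $S\in M_q$ with $(R\otimes S)A(R\otimes S)^*=\sum_{i=1}^s E_i\otimes F_i$, where $s\ge 1$, $E_1=\frac{1}{\sqrt p}Id$, $F_1=\frac1{\sqrt q}Id$ and $tr(E_iE_j)=tr(F_iF_j)=0$ for all $i\ne j$. For $A=\sum_i A_i\otimes B_i\in M_p\otimes M_q$ let $G_A:M_p\to M_q$, $G_A(X)=\sum_i tr(A_iX)B_i$. A linear map $T:M_p\to M_q$ is positive if it maps positive semidefinite Hermitian matrices to positive semidefinite Hermitian matrices; a positive map $T$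 is doubly stochastic if $T(\frac{Id}{\sqrt p})=\frac{Id}{\sqrt q}$ and $T^*(\frac{Id}{\sqrt q})=\frac{Id}{\sqrt p}$, where $T^*$ is the adjoint for the trace inner product $\langle X,Y\rangle=tr(XY^*)$; and $T$ is equivalent to a doubly stochastic map if $X\mapsto S\,T(RXR^*)\,S^*$ is doubly stochastic for some invertible $R\in M_p$, $S\in M_q$. Then $\widetilde B$ is PPT, and $B$ can be put in the filter normal form if and only if $\widetilde B$ can be put in the filter normal form. Moreover, $B$ can be put in the filter normal form if and only if the map $G_{\widetilde B}((\cdot)^t):M_{mk}\to M_{mk}$, $X\mapsto G_{\widetilde B}(X^t)$, is equivalent to a doubly stochastic map (so that the question for the rectangular matrix $B$ is reduced to the question, for the PPT matrix $\widetilde B$ of $M_{mk}\otimes M_{mk}$, that is treated in the square case). -/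

import Mathlib

open scoped Kronecker ComplexOrder

set_option linter.unusedSectionVars false

noncomputable section

namespace PPTFilter

variable {ι κ : Type*} [Fintype ι] [DecidableEq ι] [Fintype κ] [DecidableEq κ]

/-- The partial transposition `A ↦ A^{t₂}` on `M_ι ⊗ M_κ ≃ M_{ι × κ}` (Kronecker identification):
the linear map with `(X ⊗ Y)^{t₂} = X ⊗ Yᵗ`. -/
def partialTranspose (A : Matrix (ι × κ) (ι × κ) ℂ) : Matrix (ι × κ) (ι × κ) ℂ :=
  Matrix.of fun p q => A (p.1, q.2) (q.1, p.2)

/-- Positive under partial transposition: `A` and `A^{t₂}` are positive semidefinite Hermitian. -/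
def IsPPT (A : Matrix (ι × κ) (ι × κ) ℂ) : Prop :=
  A.PosSemidef ∧ (partialTranspose A).PosSemidef

/-- `A ∈ M_ι ⊗ M_κ` can be put in the filter normal form: for some invertible `R`, `S`,
`(R ⊗ S) A (R ⊗ S)* = ∑ᵢ Cᵢ ⊗ Dᵢ`, where the first pair is `Id / √k`, `Id / √m`
(`k`, `m` the sizes) and `tr (Cᵢ Cⱼ) = tr (Dᵢ Dⱼ) = 0` for `i ≠ j`. -/
def HasFilterNormalForm (A : Matrix (ι × κ) (ι × κ) ℂ) : Prop :=
  ∃ (R : Matrix ι ι ℂ) (S : Matrix κ κ ℂ), IsUnit R ∧ IsUnit S ∧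
    ∃ (s : ℕ) (C : Fin (s + 1) → Matrix ι ι ℂ) (D : Fin (s + 1) → Matrix κ κ ℂ),
      (R ⊗ₖ S) * A * (R ⊗ₖ S).conjTranspose = ∑ i, C i ⊗ₖ D i ∧
      C 0 = ((1 / Real.sqrt (Fintype.card ι) : ℝ) : ℂ) • (1 : Matrix ι ι ℂ) ∧
      D 0 = ((1 / Real.sqrt (Fintype.card κ) : ℝ) : ℂ) • (1 : Matrix κ κ ℂ) ∧
      ∀ i j, i ≠ j → (C i * C j).trace = 0 ∧ (D i * D j).trace = 0

/-- The map `G_A : M_ι → M_κ`, in coordinates; for `A = ∑ᵢ Aᵢ ⊗ Bᵢ` it is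
`X ↦ ∑ᵢ tr (Aᵢ X) Bᵢ`, see `mapG_sum_kronecker`. -/
def mapG (A : Matrix (ι × κ) (ι × κ) ℂ) : Matrix ι ι ℂ →ₗ[ℂ] Matrix κ κ ℂ where
  toFun X := Matrix.of fun p q => ∑ i, ∑ j, A (i, p) (j, q) * X j i
  map_add' X Y := by
    ext p q
    simp [mul_add, Finset.sum_add_distrib]
  map_smul' c X := by
    ext p q
    simp [Finset.mul_sum, mul_left_comm]

/-- The map `G_A((·)ᵗ) : X ↦ G_A(Xᵗ)`. -/
def mapGTranspose (A : Matrix (ι × κ) (ι × κ) ℂ) : Matrix ι ι ℂ →ₗ[ℂ] Matrix κ κ ℂ :=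
  (mapG A).comp (Matrix.transposeLinearEquiv ι ι ℂ ℂ).toLinearMap

/-- The adjoint `T*` of `T` for the trace inner product `⟨X, Y⟩ = tr (X Y*)`, in coordinates;
see `trace_traceAdjoint`. -/
def traceAdjoint (T : Matrix ι ι ℂ →ₗ[ℂ] Matrix κ κ ℂ) (Y : Matrix κ κ ℂ) : Matrix ι ι ℂ :=
  Matrix.of fun i j => star ((T (Matrix.single i j 1) * Y.conjTranspose).trace)

/-- A positive map: positive semidefinite Hermitian matrices are mapped to such matrices. -/
def IsPositiveMap (T : Matrix ι ι ℂ →ₗ[ℂ] Matrix κ κ ℂ) : Prop :=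
  ∀ X : Matrix ι ι ℂ, X.PosSemidef → (T X).PosSemidef

/-- A doubly stochastic map: a positive map with `T(Id/√k) = Id/√m` and `T*(Id/√m) = Id/√k`. -/
def IsDoublyStochastic (T : Matrix ι ι ℂ →ₗ[ℂ] Matrix κ κ ℂ) : Prop :=
  IsPositiveMap T ∧
  T (((1 / Real.sqrt (Fintype.card ι) : ℝ) : ℂ) • (1 : Matrix ι ι ℂ)) =
    ((1 / Real.sqrt (Fintype.card κ) : ℝ) : ℂ) • (1 : Matrix κ κ ℂ) ∧
  traceAdjoint T (((1 / Real.sqrt (Fintype.card κ) : ℝ) : ℂ) • (1 : Matrix κ κ ℂ)) =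
    ((1 / Real.sqrt (Fintype.card ι) : ℝ) : ℂ) • (1 : Matrix ι ι ℂ)

/-- Equivalence of maps: `L₂(X) = S L₁(R X R*) S*` with `R`, `S` invertible. -/
def MapEquivalent (L₁ L₂ : Matrix ι ι ℂ →ₗ[ℂ] Matrix κ κ ℂ) : Prop :=
  ∃ (R : Matrix ι ι ℂ) (S : Matrix κ κ ℂ), IsUnit R ∧ IsUnit S ∧
    ∀ X, L₂ X = S * L₁ (R * X * R.conjTranspose) * S.conjTranspose

/-- `T` is equivalent to a doubly stochastic map. -/
def EquivalentToDoublyStochastic (T : Matrix ι ι ℂ →ₗ[ℂ] Matrix κ κ ℂ) : Prop :=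
  ∃ L : Matrix ι ι ℂ →ₗ[ℂ] Matrix κ κ ℂ, IsDoublyStochastic L ∧ MapEquivalent T L

theorem partialTranspose_sum_kronecker {n : ℕ} (C : Fin n → Matrix ι ι ℂ)
    (D : Fin n → Matrix κ κ ℂ) :
    partialTranspose (∑ i, C i ⊗ₖ D i) = ∑ i, C i ⊗ₖ (D i).transpose := by
  ext p q
  simp [partialTranspose, Matrix.sum_apply, Matrix.kroneckerMap_apply]

theorem mapG_sum_kronecker {n : ℕ} (C : Fin n → Matrix ι ι ℂ) (D : Fin n → Matrix κ κ ℂ)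
    (X : Matrix ι ι ℂ) :
    mapG (∑ i, C i ⊗ₖ D i) X = ∑ i, (C i * X).trace • D i := by
  ext p q
  simp only [mapG, LinearMap.coe_mk, AddHom.coe_mk, Matrix.of_apply, Matrix.sum_apply,
    Matrix.kroneckerMap_apply, Matrix.smul_apply, Matrix.trace, Matrix.diag, Matrix.mul_apply,
    smul_eq_mul, Finset.sum_mul]
  conv_rhs => rw [Finset.sum_comm]
  refine Finset.sum_congr rfl fun i _ => ?_
  conv_rhs => rw [Finset.sum_comm]
  refine Finset.sum_congr rfl fun j _ => Finset.sum_congr rfl fun l _ => ?_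
  ring

theorem trace_traceAdjoint (T : Matrix ι ι ℂ →ₗ[ℂ] Matrix κ κ ℂ) (X : Matrix ι ι ℂ)
    (Y : Matrix κ κ ℂ) :
    (T X * Y.conjTranspose).trace = (X * (traceAdjoint T Y).conjTranspose).trace := by
  conv_lhs => rw [Matrix.matrix_eq_sum_single X]
  have h : ∀ i j, Matrix.single i j (X i j) = X i j • Matrix.single i j (1 : ℂ) := by
    intro i j
    simp [Matrix.smul_single]
  simp only [h, map_sum, map_smul, Finset.sum_mul, Matrix.smul_mul, Matrix.trace_sum,
    Matrix.trace_smul]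
  simp [Matrix.trace, Matrix.mul_apply, traceAdjoint, Matrix.conjTranspose_apply]

/-- `B̃ = ∑ᵢ (Id_m ⊗ Cᵢ) ⊗ (Dᵢ ⊗ Id_k) ∈ M_{mk} ⊗ M_{mk}`, with `M_m ⊗ M_k ≃ M_{mk}`. -/
def tildeMatrix {n k m : ℕ} (C : Fin n → Matrix (Fin k) (Fin k) ℂ)
    (D : Fin n → Matrix (Fin m) (Fin m) ℂ) :
    Matrix ((Fin m × Fin k) × (Fin m × Fin k)) ((Fin m × Fin k) × (Fin m × Fin k)) ℂ :=
  ∑ i, ((1 : Matrix (Fin m) (Fin m) ℂ) ⊗ₖ C i) ⊗ₖ (D i ⊗ₖ (1 : Matrix (Fin k) (Fin k) ℂ))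

end PPTFilter

end

/-! Both properties reduce to a scaling problem. A Hermitian `A` has a filter normal form iff a
local congruence makes its marginals `G_A(Id)` and `G_A^*(Id)` the prescribed multiples of the
identity: the tail of the form is traceless, and conversely a Hermitian remainder with zero
marginals has a traceless orthogonal (operator Schmidt) decomposition. For positive semidefinite
`A`, balanced marginals also mean that `G_A((·)ᵗ)` is equivalent to a doubly stochastic map. With `X
= RᴴR` and `Y = SᴴS`, balance becomes `G_A(X) = c Y⁻¹`, `G_A^*(Y) = d X⁻¹`
(`hasBalancedForm_iff_isScalable`). Since `G_B̃(X)` is `G_B` of a partial trace of `X`, tensored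
with `Id`, and dually, every scaling pair of `B̃` is a product with identities; so `B̃` and `B` are
scalable together (`isScalable_tildeMatrix_iff`). -/

namespace PPTFilter

open Matrix

/-! ### Marginal maps, local congruences and scaling pairs -/

section Maps

variable {ι κ : Type*} [Fintype ι] [DecidableEq ι] [Fintype κ] [DecidableEq κ]

/-- The map `M_κ → M_ι` with the roles of the two tensor factors exchanged:
`Y ↦ ∑ᵢ tr (Bᵢ Y) Aᵢ` for `A = ∑ᵢ Aᵢ ⊗ Bᵢ`. -/
noncomputable def dualMapG (A : Matrix (ι × κ) (ι × κ) ℂ) :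
    Matrix κ κ ℂ →ₗ[ℂ] Matrix ι ι ℂ :=
  mapG (A.submatrix Prod.swap Prod.swap)

/-- Matrix units are Kronecker products, so identities additive in `A` need checking only on simple
tensors. -/
theorem kronecker_induction {P : Matrix (ι × κ) (ι × κ) ℂ → Prop} (A : Matrix (ι × κ) (ι × κ) ℂ)
    (zero : P 0) (add : ∀ A B, P A → P B → P (A + B))
    (kron : ∀ (C : Matrix ι ι ℂ) (D : Matrix κ κ ℂ), P (C ⊗ₖ D)) : P A := by
  refine Matrix.induction_on' A zero add fun i j x => ?_
  have h := kron (Matrix.single i.1 j.1 x) (Matrix.single i.2 j.2 1)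
  rwa [Matrix.single_kronecker_single, mul_one] at h

theorem mapG_zero : mapG (0 : Matrix (ι × κ) (ι × κ) ℂ) = 0 := by
  ext X p q
  simp [mapG]

theorem mapG_add (A B : Matrix (ι × κ) (ι × κ) ℂ) : mapG (A + B) = mapG A + mapG B := by
  ext X p q
  simp [mapG, add_mul, Finset.sum_add_distrib]

theorem mapG_sub (A B : Matrix (ι × κ) (ι × κ) ℂ) : mapG (A - B) = mapG A - mapG B := by
  ext X p q
  simp [mapG, sub_mul, Finset.sum_sub_distrib]

theorem mapG_kronecker (C : Matrix ι ι ℂ) (D : Matrix κ κ ℂ) (X : Matrix ι ι ℂ) :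
    mapG (C ⊗ₖ D) X = (C * X).trace • D := by
  simpa using mapG_sum_kronecker (n := 1) (fun _ => C) (fun _ => D) X

theorem submatrix_swap_kronecker (C : Matrix ι ι ℂ) (D : Matrix κ κ ℂ) :
    (C ⊗ₖ D).submatrix Prod.swap Prod.swap = D ⊗ₖ C := by
  ext p q
  simp [Matrix.kroneckerMap_apply, mul_comm]

theorem dualMapG_zero : dualMapG (0 : Matrix (ι × κ) (ι × κ) ℂ) = 0 := mapG_zero

theorem dualMapG_add (A B : Matrix (ι × κ) (ι × κ) ℂ) :
    dualMapG (A + B) = dualMapG A + dualMapG B := mapG_add _ _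

theorem dualMapG_sub (A B : Matrix (ι × κ) (ι × κ) ℂ) :
    dualMapG (A - B) = dualMapG A - dualMapG B := mapG_sub _ _

theorem dualMapG_kronecker (C : Matrix ι ι ℂ) (D : Matrix κ κ ℂ) (Y : Matrix κ κ ℂ) :
    dualMapG (C ⊗ₖ D) Y = (D * Y).trace • C := by
  rw [dualMapG, submatrix_swap_kronecker, mapG_kronecker]

theorem dualMapG_sum_kronecker {n : ℕ} (C : Fin n → Matrix ι ι ℂ) (D : Fin n → Matrix κ κ ℂ)
    (Y : Matrix κ κ ℂ) :
    dualMapG (∑ i, C i ⊗ₖ D i) Y = ∑ i, (D i * Y).trace • C i := by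
  have h : (∑ i, C i ⊗ₖ D i).submatrix Prod.swap Prod.swap = ∑ i, D i ⊗ₖ C i := by
    ext p q
    simp [Matrix.sum_apply, Matrix.kroneckerMap_apply, mul_comm]
  rw [dualMapG, h, mapG_sum_kronecker]

/-- Both sides equal `tr (A (X ⊗ Y))`: the duality is for the bilinear trace form, without
conjugation. -/
theorem trace_mapG_mul (A : Matrix (ι × κ) (ι × κ) ℂ) (X : Matrix ι ι ℂ) (Y : Matrix κ κ ℂ) :
    (mapG A X * Y).trace = (dualMapG A Y * X).trace := by
  induction A using kronecker_induction with
  | zero => simp [mapG_zero, dualMapG_zero]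
  | add A B hA hB => simp [mapG_add, dualMapG_add, add_mul, hA, hB]
  | kron C D => simp [mapG_kronecker, dualMapG_kronecker, mul_comm]

theorem mapG_conj (A : Matrix (ι × κ) (ι × κ) ℂ) (R : Matrix ι ι ℂ) (S : Matrix κ κ ℂ)
    (X : Matrix ι ι ℂ) :
    mapG ((R ⊗ₖ S) * A * (R ⊗ₖ S)ᴴ) X = S * mapG A (Rᴴ * X * R) * Sᴴ := by
  induction A using kronecker_induction with
  | zero => simp [mapG_zero]
  | add A B hA hB => simp [mapG_add, mul_add, add_mul, hA, hB]
  | kron C D =>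
    rw [conjTranspose_kronecker, ← mul_kronecker_mul, ← mul_kronecker_mul, mapG_kronecker,
      mapG_kronecker, mul_smul_comm, smul_mul_assoc]
    congr 1
    rw [Matrix.mul_assoc, Matrix.mul_assoc, Matrix.trace_mul_comm]
    simp only [Matrix.mul_assoc]

theorem dualMapG_conj (A : Matrix (ι × κ) (ι × κ) ℂ) (R : Matrix ι ι ℂ) (S : Matrix κ κ ℂ)
    (Y : Matrix κ κ ℂ) :
    dualMapG ((R ⊗ₖ S) * A * (R ⊗ₖ S)ᴴ) Y = R * dualMapG A (Sᴴ * Y * S) * Rᴴ := by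
  induction A using kronecker_induction with
  | zero => simp [dualMapG_zero]
  | add A B hA hB => simp [dualMapG_add, mul_add, add_mul, hA, hB]
  | kron C D =>
    rw [conjTranspose_kronecker, ← mul_kronecker_mul, ← mul_kronecker_mul, dualMapG_kronecker,
      dualMapG_kronecker, mul_smul_comm, smul_mul_assoc]
    congr 1
    rw [Matrix.mul_assoc, Matrix.mul_assoc, Matrix.trace_mul_comm]
    simp only [Matrix.mul_assoc]

theorem isHermitian_dualMapG {A : Matrix (ι × κ) (ι × κ) ℂ} (hA : A.IsHermitian)
    {Y : Matrix κ κ ℂ} (hY : Y.IsHermitian) : (dualMapG A Y).IsHermitian := by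
  ext i j
  simp only [dualMapG, mapG, conjTranspose_apply, LinearMap.coe_mk, AddHom.coe_mk, of_apply,
    submatrix_apply, Prod.swap_prod_mk, star_sum, star_mul', hA.apply, hY.apply]
  exact Finset.sum_comm

open scoped MatrixOrder in
theorem exists_conjTranspose_mul_self {n : Type*} [Fintype n] [DecidableEq n]
    {X : Matrix n n ℂ} (hX : X.PosSemidef) : ∃ R : Matrix n n ℂ, X = Rᴴ * R :=
  CStarAlgebra.nonneg_iff_eq_star_mul_self.mp hX.nonneg

theorem exists_isUnit_conjTranspose_mul_self {n : Type*} [Fintype n] [DecidableEq n]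
    {X : Matrix n n ℂ} (hX : X.PosDef) : ∃ R : Matrix n n ℂ, IsUnit R ∧ X = Rᴴ * R := by
  obtain ⟨R, hR⟩ := exists_conjTranspose_mul_self hX.posSemidef
  refine ⟨R, ?_, hR⟩
  have h := hX.isUnit
  rw [hR, isUnit_iff_isUnit_det, det_mul] at h
  exact (isUnit_iff_isUnit_det R).mpr (isUnit_of_mul_isUnit_right h)

theorem posDef_conjTranspose_mul_self {n : Type*} [Fintype n] [DecidableEq n]
    {R : Matrix n n ℂ} (hR : IsUnit R) : (Rᴴ * R).PosDef :=
  .conjTranspose_mul_self R (mulVec_injective_iff_isUnit.mpr hR)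

/-- Factoring `X = RᴴR` and moving `R` into `A` reduces to `X = 1`, where the value is a partial
trace, a sum of principal submatrices. -/
theorem posSemidef_mapG {A : Matrix (ι × κ) (ι × κ) ℂ} (hA : A.PosSemidef)
    {X : Matrix ι ι ℂ} (hX : X.PosSemidef) : (mapG A X).PosSemidef := by
  obtain ⟨R, rfl⟩ := exists_conjTranspose_mul_self hX
  have h := mapG_conj A R 1 1
  simp only [Matrix.mul_one, Matrix.one_mul, conjTranspose_one] at h
  rw [← h]
  have hA' := hA.mul_mul_conjTranspose_same (R ⊗ₖ (1 : Matrix κ κ ℂ))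
  generalize (R ⊗ₖ (1 : Matrix κ κ ℂ)) * A * (R ⊗ₖ (1 : Matrix κ κ ℂ))ᴴ = A' at hA' ⊢
  have hsum : mapG A' 1 = ∑ i, A'.submatrix (fun p => (i, p)) (fun p => (i, p)) := by
    ext p q
    simp [mapG, Matrix.sum_apply, Matrix.one_apply]
  rw [hsum]
  exact posSemidef_sum _ fun i _ => hA'.submatrix _

/-- `A` has, after an invertible local congruence, marginals proportional to the identity with
the constants of the filter normal form. -/
def HasBalancedForm (A : Matrix (ι × κ) (ι × κ) ℂ) : Prop :=
  ∃ (R : Matrix ι ι ℂ) (S : Matrix κ κ ℂ), IsUnit R ∧ IsUnit S ∧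
    mapG ((R ⊗ₖ S) * A * (R ⊗ₖ S)ᴴ) 1 =
      ((√(Fintype.card ι) / √(Fintype.card κ) : ℝ) : ℂ) • (1 : Matrix κ κ ℂ) ∧
    dualMapG ((R ⊗ₖ S) * A * (R ⊗ₖ S)ᴴ) 1 =
      ((√(Fintype.card κ) / √(Fintype.card ι) : ℝ) : ℂ) • (1 : Matrix ι ι ℂ)

/-- A scaling pair of positive definite matrices for `G_A` and its dual. -/
def IsScalable (A : Matrix (ι × κ) (ι × κ) ℂ) : Prop :=
  ∃ (X : Matrix ι ι ℂ) (Y : Matrix κ κ ℂ) (c d : ℝ), X.PosDef ∧ Y.PosDef ∧ 0 < c ∧ 0 < d ∧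
    mapG A X = (c : ℂ) • Y⁻¹ ∧ dualMapG A Y = (d : ℂ) • X⁻¹

/-- The right side involves `S` only through `Sᴴ * S`, so congruence factors can be traded for
positive definite matrices. -/
theorem conj_eq_smul_one_iff {n : Type*} [Fintype n] [DecidableEq n] {S : Matrix n n ℂ}
    (hS : IsUnit S) (M : Matrix n n ℂ) (c : ℂ) :
    S * M * Sᴴ = c • (1 : Matrix n n ℂ) ↔ M = c • (Sᴴ * S)⁻¹ := by
  have h1 : IsUnit S.det := (isUnit_iff_isUnit_det S).mp hS
  have h2 : IsUnit Sᴴ.det := by rw [det_conjTranspose]; exact h1.star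
  rw [Matrix.mul_inv_rev]
  constructor
  · intro h
    have h3 : M = S⁻¹ * (S * M * Sᴴ) * Sᴴ⁻¹ := by
      rw [Matrix.mul_assoc S, nonsing_inv_mul_cancel_left _ _ h1, mul_nonsing_inv_cancel_right _ _ h2]
    rw [h3, h]
    simp
  · rintro rfl
    rw [mul_smul_comm, smul_mul_assoc, mul_nonsing_inv_cancel_left _ _ h1, nonsing_inv_mul _ h2]

theorem HasBalancedForm.isScalable [Nonempty ι] [Nonempty κ] {A : Matrix (ι × κ) (ι × κ) ℂ}
    (h : HasBalancedForm A) : IsScalable A := by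
  obtain ⟨R, S, hR, hS, h1, h2⟩ := h
  rw [mapG_conj, Matrix.mul_one, conj_eq_smul_one_iff hS] at h1
  rw [dualMapG_conj, Matrix.mul_one, conj_eq_smul_one_iff hR] at h2
  have hι : (0 : ℝ) < Fintype.card ι := by exact_mod_cast Fintype.card_pos
  have hκ : (0 : ℝ) < Fintype.card κ := by exact_mod_cast Fintype.card_pos
  exact ⟨Rᴴ * R, Sᴴ * S, _, _, posDef_conjTranspose_mul_self hR, posDef_conjTranspose_mul_self hS,
    by positivity, by positivity, h1, h2⟩

theorem inv_real_smul {n : Type*} [Fintype n] [DecidableEq n] {s : ℝ} (hs : 0 < s)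
    {Y : Matrix n n ℂ} (hY : IsUnit Y) : ((s : ℂ) • Y)⁻¹ = (s : ℂ)⁻¹ • Y⁻¹ := by
  have hs' : (s : ℂ) ≠ 0 := by exact_mod_cast hs.ne'
  refine inv_eq_right_inv ?_
  rw [smul_mul_smul_comm, mul_nonsing_inv _ ((isUnit_iff_isUnit_det Y).mp hY),
    mul_inv_cancel₀ hs', one_smul]

theorem IsScalable.hasBalancedForm [Nonempty ι] [Nonempty κ] {A : Matrix (ι × κ) (ι × κ) ℂ}
    (h : IsScalable A) : HasBalancedForm A := by
  obtain ⟨X, Y, c, d, hX, hY, hc, hd, h1, h2⟩ := h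
  have hι : (0 : ℝ) < Fintype.card ι := by exact_mod_cast Fintype.card_pos
  have hκ : (0 : ℝ) < Fintype.card κ := by exact_mod_cast Fintype.card_pos
  -- Evaluating `tr (G_A(X) Y)` in two ways ties `d` to `c`.
  have htr : c * Fintype.card κ = d * Fintype.card ι := by
    have h := trace_mapG_mul A X Y
    rw [h1, h2, smul_mul_assoc, smul_mul_assoc,
      nonsing_inv_mul _ ((isUnit_iff_isUnit_det Y).mp hY.isUnit),
      nonsing_inv_mul _ ((isUnit_iff_isUnit_det X).mp hX.isUnit)] at h
    simp only [trace_smul, trace_one, smul_eq_mul] at h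
    exact_mod_cast h
  -- Replacing `Y` by `sY` multiplies both constants by `s`; by `htr` one choice of `s` normalizes
  -- both.
  set s : ℝ := √(Fintype.card ι) / √(Fintype.card κ) / c with hs_def
  have hs : 0 < s := by positivity
  have hs' : (s : ℂ) ≠ 0 := by exact_mod_cast hs.ne'
  have hsc : s * c = √(Fintype.card ι) / √(Fintype.card κ) := by
    rw [hs_def]; field_simp
  have hsd : s * d = √(Fintype.card κ) / √(Fintype.card ι) := by
    have hd' : d = c * Fintype.card κ / Fintype.card ι := by
      rw [htr]; field_simp
    rw [hd', ← mul_div_assoc, ← mul_assoc, hsc]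
    have e1 := Real.sq_sqrt hι.le
    have e2 := Real.sq_sqrt hκ.le
    have p1 := Real.sqrt_pos.mpr hι
    have p2 := Real.sqrt_pos.mpr hκ
    generalize √(Fintype.card ι : ℝ) = u at *
    generalize √(Fintype.card κ : ℝ) = v at *
    rw [← e1, ← e2]
    field_simp
  obtain ⟨R, hR, rfl⟩ := exists_isUnit_conjTranspose_mul_self hX
  have hsY : ((s : ℂ) • Y).PosDef := hY.smul (by exact_mod_cast hs)
  obtain ⟨S, hS, hSY⟩ := exists_isUnit_conjTranspose_mul_self hsY
  refine ⟨R, S, hR, hS, ?_, ?_⟩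
  · rw [mapG_conj, Matrix.mul_one, conj_eq_smul_one_iff hS, h1, ← hSY,
      inv_real_smul hs hY.isUnit, ← hsc, smul_smul]
    congr 1
    push_cast
    field_simp
  · rw [dualMapG_conj, Matrix.mul_one, conj_eq_smul_one_iff hR, ← hSY, map_smul, h2, smul_smul,
      ← hsd]
    push_cast
    rfl

theorem hasBalancedForm_iff_isScalable [Nonempty ι] [Nonempty κ]
    {A : Matrix (ι × κ) (ι × κ) ℂ} : HasBalancedForm A ↔ IsScalable A :=
  ⟨HasBalancedForm.isScalable, IsScalable.hasBalancedForm⟩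

end Maps

end PPTFilter

namespace PPTFilter

open Matrix

/-! ### Balanced marginals and doubly stochastic maps -/

section DoublyStochastic

variable {ι κ : Type*} [Fintype ι] [DecidableEq ι] [Fintype κ] [DecidableEq κ]

theorem mapGTranspose_apply (A : Matrix (ι × κ) (ι × κ) ℂ) (X : Matrix ι ι ℂ) :
    mapGTranspose A X = mapG A Xᵀ := rfl

theorem isPositiveMap_mapGTranspose {A : Matrix (ι × κ) (ι × κ) ℂ} (hA : A.PosSemidef) :
    IsPositiveMap (mapGTranspose A) :=
  fun _ hX => posSemidef_mapG hA hX.transpose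

/-- The sesquilinear adjoint and the transposition together leave an entrywise conjugate of the
bilinear dual. -/
theorem traceAdjoint_mapGTranspose (A : Matrix (ι × κ) (ι × κ) ℂ) (Y : Matrix κ κ ℂ) :
    traceAdjoint (mapGTranspose A) Y = (dualMapG A Yᴴ).map star := by
  ext i j
  simp [traceAdjoint, mapGTranspose_apply, trace_mapG_mul, trace_mul_single]

theorem mapGTranspose_conj (A : Matrix (ι × κ) (ι × κ) ℂ) (R : Matrix ι ι ℂ) (S : Matrix κ κ ℂ)
    (X : Matrix ι ι ℂ) :
    mapGTranspose ((Rᵀ ⊗ₖ S) * A * (Rᵀ ⊗ₖ S)ᴴ) X =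
      S * mapGTranspose A (R * X * Rᴴ) * Sᴴ := by
  rw [mapGTranspose_apply, mapGTranspose_apply, mapG_conj, transpose_mul, transpose_mul,
    ← Matrix.mul_assoc Rᴴᵀ]
  rfl

theorem one_div_smul_eq_iff {n : Type*} [DecidableEq n] {M : Matrix n n ℂ} {a b : ℂ}
    (ha : a ≠ 0) : (1 / a) • M = (1 / b) • (1 : Matrix n n ℂ) ↔ M = (a / b) • 1 := by
  constructor
  · intro h
    have := congrArg (a • ·) h
    simpa [smul_smul, ha, div_eq_mul_inv] using this
  · rintro rfl
    rw [smul_smul]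
    congr 1
    field_simp

theorem isDoublyStochastic_mapGTranspose_iff [Nonempty ι] [Nonempty κ]
    {A : Matrix (ι × κ) (ι × κ) ℂ} (hA : A.PosSemidef) :
    IsDoublyStochastic (mapGTranspose A) ↔
      mapG A 1 = ((√(Fintype.card ι) / √(Fintype.card κ) : ℝ) : ℂ) • (1 : Matrix κ κ ℂ) ∧
      dualMapG A 1 = ((√(Fintype.card κ) / √(Fintype.card ι) : ℝ) : ℂ) • (1 : Matrix ι ι ℂ) := by
  have hι : (0 : ℝ) < √(Fintype.card ι) :=
    Real.sqrt_pos.mpr (by exact_mod_cast Fintype.card_pos)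
  have hκ : (0 : ℝ) < √(Fintype.card κ) :=
    Real.sqrt_pos.mpr (by exact_mod_cast Fintype.card_pos)
  rw [IsDoublyStochastic, and_iff_right (isPositiveMap_mapGTranspose hA)]
  generalize √(Fintype.card ι : ℝ) = u at *
  generalize √(Fintype.card κ : ℝ) = v at *
  have hu : (u : ℂ) ≠ 0 := by exact_mod_cast hι.ne'
  have hv : (v : ℂ) ≠ 0 := by exact_mod_cast hκ.ne'
  refine and_congr ?_ ?_
  · rw [map_smul, mapGTranspose_apply, transpose_one]
    push_cast
    exact one_div_smul_eq_iff hu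
  · rw [traceAdjoint_mapGTranspose, conjTranspose_smul, conjTranspose_one, map_smul]
    -- Entrywise conjugation is injective and fixes real multiples of the identity, so it can be
    -- dropped.
    have e : ((((star ((1 / v : ℝ) : ℂ)) • dualMapG A 1).map star =
        ((1 / u : ℝ) : ℂ) • (1 : Matrix ι ι ℂ)) ↔
        (1 / (v : ℂ)) • dualMapG A 1 = (1 / (u : ℂ)) • (1 : Matrix ι ι ℂ)) := by
      have h1 : (((star ((1 / v : ℝ) : ℂ)) • dualMapG A 1).map star) =
          ((1 / (v : ℂ)) • dualMapG A 1).map star := by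
        simp
      have h2 : ((1 / u : ℝ) : ℂ) • (1 : Matrix ι ι ℂ) =
          ((1 / (u : ℂ)) • (1 : Matrix ι ι ℂ)).map star := by
        ext i j
        by_cases h : i = j <;> simp [h]
      rw [h1, h2]
      exact (map_injective star_injective).eq_iff
    rw [e]
    push_cast
    exact one_div_smul_eq_iff hv

theorem equivalentToDoublyStochastic_mapGTranspose_iff [Nonempty ι] [Nonempty κ]
    {A : Matrix (ι × κ) (ι × κ) ℂ} (hA : A.PosSemidef) :
    EquivalentToDoublyStochastic (mapGTranspose A) ↔ HasBalancedForm A := by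
  constructor
  · rintro ⟨L, hL, R, S, hR, hS, h⟩
    have hL' : L = mapGTranspose ((Rᵀ ⊗ₖ S) * A * (Rᵀ ⊗ₖ S)ᴴ) :=
      LinearMap.ext fun X => by rw [h X, mapGTranspose_conj]
    rw [hL', isDoublyStochastic_mapGTranspose_iff (hA.mul_mul_conjTranspose_same _)] at hL
    exact ⟨Rᵀ, S, (isUnit_transpose R).mpr hR, hS, hL⟩
  · rintro ⟨R, S, hR, hS, h⟩
    refine ⟨mapGTranspose ((R ⊗ₖ S) * A * (R ⊗ₖ S)ᴴ),
      (isDoublyStochastic_mapGTranspose_iff (hA.mul_mul_conjTranspose_same _)).mpr h,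
      Rᵀ, S, (isUnit_transpose R).mpr hR, hS, fun X => ?_⟩
    rw [← mapGTranspose_conj, transpose_transpose]

end DoublyStochastic

/-! ### Reduction of `B̃` to `B` by partial traces -/

section Tilde

variable {n k m : ℕ} (C : Fin n → Matrix (Fin k) (Fin k) ℂ) (D : Fin n → Matrix (Fin m) (Fin m) ℂ)

/-- The partial trace over the first tensor factor. -/
def partialTraceLeft {ι κ : Type*} [Fintype ι] (X : Matrix (ι × κ) (ι × κ) ℂ) : Matrix κ κ ℂ :=
  ∑ i, X.submatrix (fun p => (i, p)) (fun p => (i, p))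

/-- The partial trace over the second tensor factor. -/
def partialTraceRight {ι κ : Type*} [Fintype κ] (X : Matrix (ι × κ) (ι × κ) ℂ) : Matrix ι ι ℂ :=
  ∑ p, X.submatrix (fun i => (i, p)) (fun i => (i, p))

theorem partialTraceLeft_smul_one_kronecker {ι κ : Type*} [Fintype ι] [DecidableEq ι] (c : ℂ)
    (X : Matrix κ κ ℂ) :
    partialTraceLeft (c • ((1 : Matrix ι ι ℂ) ⊗ₖ X)) = (Fintype.card ι * c) • X := by
  ext p q
  simp [partialTraceLeft, Matrix.sum_apply, kroneckerMap_apply, mul_assoc]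

theorem partialTraceRight_smul_kronecker_one {ι κ : Type*} [Fintype κ] [DecidableEq κ] (c : ℂ)
    (X : Matrix ι ι ℂ) :
    partialTraceRight (c • (X ⊗ₖ (1 : Matrix κ κ ℂ))) = (Fintype.card κ * c) • X := by
  ext p q
  simp [partialTraceRight, Matrix.sum_apply, kroneckerMap_apply, mul_assoc]

theorem trace_one_kronecker_mul {ι κ : Type*} [Fintype ι] [DecidableEq ι] [Fintype κ]
    (C : Matrix κ κ ℂ) (X : Matrix (ι × κ) (ι × κ) ℂ) :
    (((1 : Matrix ι ι ℂ) ⊗ₖ C) * X).trace = (C * partialTraceLeft X).trace := by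
  simp only [trace, diag, mul_apply, partialTraceLeft, Matrix.sum_apply, kroneckerMap_apply,
    submatrix_apply, Fintype.sum_prod_type, one_apply, ite_mul, one_mul, zero_mul,
    Finset.sum_ite_irrel, Finset.sum_const_zero, Finset.sum_ite_eq, Finset.mem_univ, if_true,
    Finset.mul_sum]
  rw [Finset.sum_comm]
  exact Finset.sum_congr rfl fun _ _ => Finset.sum_comm

theorem trace_kronecker_one_mul {ι κ : Type*} [Fintype ι] [DecidableEq κ] [Fintype κ]
    (D : Matrix ι ι ℂ) (X : Matrix (ι × κ) (ι × κ) ℂ) :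
    ((D ⊗ₖ (1 : Matrix κ κ ℂ)) * X).trace = (D * partialTraceRight X).trace := by
  simp only [trace, diag, mul_apply, partialTraceRight, Matrix.sum_apply, kroneckerMap_apply,
    submatrix_apply, Fintype.sum_prod_type, one_apply, mul_ite, ite_mul, mul_one, mul_zero,
    zero_mul, Finset.sum_ite_eq, Finset.mem_univ, if_true, Finset.mul_sum]
  exact Finset.sum_congr rfl fun _ _ => Finset.sum_comm

theorem mapG_tildeMatrix (X : Matrix (Fin m × Fin k) (Fin m × Fin k) ℂ) :
    mapG (tildeMatrix C D) X =
      mapG (∑ i, C i ⊗ₖ D i) (partialTraceLeft X) ⊗ₖ (1 : Matrix (Fin k) (Fin k) ℂ) := by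
  rw [tildeMatrix, mapG_sum_kronecker, mapG_sum_kronecker]
  ext p q
  simp [Matrix.sum_apply, kroneckerMap_apply, trace_one_kronecker_mul, Finset.sum_mul, mul_assoc]

theorem dualMapG_tildeMatrix (Y : Matrix (Fin m × Fin k) (Fin m × Fin k) ℂ) :
    dualMapG (tildeMatrix C D) Y =
      (1 : Matrix (Fin m) (Fin m) ℂ) ⊗ₖ dualMapG (∑ i, C i ⊗ₖ D i) (partialTraceRight Y) := by
  rw [tildeMatrix, dualMapG_sum_kronecker, dualMapG_sum_kronecker]
  ext p q
  simp [Matrix.sum_apply, kroneckerMap_apply, trace_kronecker_one_mul, Finset.mul_sum,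
    mul_left_comm]

/-- After a permutation of the four indices, `B̃` is `B ⊗ Id`. -/
theorem posSemidef_tildeMatrix (h : (∑ i, C i ⊗ₖ D i).PosSemidef) :
    (tildeMatrix C D).PosSemidef := by
  suffices e : tildeMatrix C D =
      ((∑ i, C i ⊗ₖ D i) ⊗ₖ (1 : Matrix (Fin m × Fin k) (Fin m × Fin k) ℂ)).submatrix
        (fun x => ((x.1.2, x.2.1), (x.1.1, x.2.2)))
        (fun x => ((x.1.2, x.2.1), (x.1.1, x.2.2))) by
    rw [e]
    exact (h.kronecker .one).submatrix _
  ext x y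
  simp only [tildeMatrix, Matrix.sum_apply, kroneckerMap_apply, submatrix_apply, one_apply,
    Prod.mk.injEq, Finset.sum_mul]
  refine Finset.sum_congr rfl fun i _ => ?_
  by_cases h1 : x.1.1 = y.1.1 <;> by_cases h2 : x.2.2 = y.2.2 <;> simp [h1, h2]

theorem isPPT_tildeMatrix (h : IsPPT (∑ i, C i ⊗ₖ D i)) : IsPPT (tildeMatrix C D) := by
  refine ⟨posSemidef_tildeMatrix C D h.1, ?_⟩
  have h2 := h.2
  rw [partialTranspose_sum_kronecker] at h2
  have e : partialTranspose (tildeMatrix C D) = tildeMatrix C (fun i => (D i)ᵀ) := by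
    rw [tildeMatrix, partialTranspose_sum_kronecker, tildeMatrix]
    simp only [← kroneckerMap_transpose, transpose_one]
  rw [e]
  exact posSemidef_tildeMatrix C _ h2

theorem eq_smul_inv_of_eq_smul_inv {n : Type*} [Fintype n] [DecidableEq n] {c : ℝ} (hc : 0 < c)
    {Z Y : Matrix n n ℂ} (hY : IsUnit Y) (h : Z = (c : ℂ) • Y⁻¹) : Y = (c : ℂ) • Z⁻¹ := by
  have hc' : (c : ℂ) ≠ 0 := by exact_mod_cast hc.ne'
  rw [h, inv_real_smul hc ((isUnit_nonsing_inv_iff).mpr hY),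
    nonsing_inv_nonsing_inv _ ((isUnit_iff_isUnit_det Y).mp hY), smul_smul, mul_inv_cancel₀ hc',
    one_smul]

theorem isScalable_tildeMatrix_iff (hk : 0 < k) (hm : 0 < m) :
    IsScalable (tildeMatrix C D) ↔ IsScalable (∑ i, C i ⊗ₖ D i) := by
  have hk' : (0 : ℝ) < k := by exact_mod_cast hk
  have hm' : (0 : ℝ) < m := by exact_mod_cast hm
  constructor
  · rintro ⟨X, Y, c, d, hX, hY, hc, hd, h1, h2⟩
    rw [mapG_tildeMatrix] at h1
    rw [dualMapG_tildeMatrix] at h2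
    -- Inverting the scaling equations forces `Y = c (W⁻¹ ⊗ 1)` and `X = d (1 ⊗ V⁻¹)`, with `W`, `V`
    -- as named below.
    have hYeq := eq_smul_inv_of_eq_smul_inv hc hY.isUnit h1
    have hXeq := eq_smul_inv_of_eq_smul_inv hd hX.isUnit h2
    rw [inv_kronecker, inv_one] at hYeq hXeq
    generalize hW : mapG (∑ i, C i ⊗ₖ D i) (partialTraceLeft X) = W at *
    generalize hV : dualMapG (∑ i, C i ⊗ₖ D i) (partialTraceRight Y) = V at *
    have hcC : (c : ℂ) ≠ 0 := by exact_mod_cast hc.ne'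
    have hdC : (d : ℂ) ≠ 0 := by exact_mod_cast hd.ne'
    have hkC : (k : ℂ) ≠ 0 := by exact_mod_cast hk'.ne'
    have hmC : (m : ℂ) ≠ 0 := by exact_mod_cast hm'.ne'
    -- `W⁻¹` is a positive multiple of a principal submatrix of `Y`; choosing one needs an index in
    -- `Fin k`.
    have hW' : W⁻¹.PosDef := by
      have e : W⁻¹ = ((c⁻¹ : ℝ) : ℂ) •
          Y.submatrix (fun i => (i, (⟨0, hk⟩ : Fin k))) (fun i => (i, (⟨0, hk⟩ : Fin k))) := by
        rw [hYeq]
        ext i j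
        simp [kroneckerMap_apply, hcC]
      rw [e]
      exact (hY.submatrix fun a b h => congrArg Prod.fst h).smul
        (by exact_mod_cast inv_pos.mpr hc)
    have hV' : V⁻¹.PosDef := by
      have e : V⁻¹ = ((d⁻¹ : ℝ) : ℂ) •
          X.submatrix (fun i => ((⟨0, hm⟩ : Fin m), i)) (fun i => ((⟨0, hm⟩ : Fin m), i)) := by
        rw [hXeq]
        ext i j
        simp [kroneckerMap_apply, hdC]
      rw [e]
      exact (hX.submatrix fun a b h => congrArg Prod.snd h).smul
        (by exact_mod_cast inv_pos.mpr hd)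
    have hWu := (isUnit_nonsing_inv_iff).mp hW'.isUnit
    have hVu := (isUnit_nonsing_inv_iff).mp hV'.isUnit
    rw [hXeq, partialTraceLeft_smul_one_kronecker, map_smul, Fintype.card_fin] at hW
    rw [hYeq, partialTraceRight_smul_kronecker_one, map_smul, Fintype.card_fin] at hV
    -- The partial traces of the product forms are `m d V⁻¹` and `k c W⁻¹`, whence the constants.
    refine ⟨V⁻¹, W⁻¹, (m * d)⁻¹, (k * c)⁻¹, hV', hW', by positivity, by positivity, ?_, ?_⟩
    · rw [nonsing_inv_nonsing_inv _ ((isUnit_iff_isUnit_det W).mp hWu)]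
      conv_rhs => rw [← hW]
      rw [smul_smul]
      push_cast
      rw [inv_mul_cancel₀ (mul_ne_zero hmC hdC), one_smul]
    · rw [nonsing_inv_nonsing_inv _ ((isUnit_iff_isUnit_det V).mp hVu)]
      conv_rhs => rw [← hV]
      rw [smul_smul]
      push_cast
      rw [inv_mul_cancel₀ (mul_ne_zero hkC hcC), one_smul]
  · rintro ⟨X, Y, c, d, hX, hY, hc, hd, h1, h2⟩
    refine ⟨(1 : Matrix (Fin m) (Fin m) ℂ) ⊗ₖ X, Y ⊗ₖ (1 : Matrix (Fin k) (Fin k) ℂ),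
      m * c, k * d, PosDef.one.kronecker hX, hY.kronecker .one, by positivity, by positivity,
      ?_, ?_⟩
    · have e := partialTraceLeft_smul_one_kronecker (ι := Fin m) 1 X
      rw [one_smul, mul_one, Fintype.card_fin] at e
      rw [mapG_tildeMatrix, inv_kronecker, inv_one, e, map_smul, h1, smul_smul,
        smul_kronecker]
      push_cast
      rfl
    · have e := partialTraceRight_smul_kronecker_one (κ := Fin k) 1 Y
      rw [one_smul, mul_one, Fintype.card_fin] at e
      rw [dualMapG_tildeMatrix, inv_kronecker, inv_one, e, map_smul, h2, smul_smul,
        kronecker_smul]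
      push_cast
      rfl

end Tilde

end PPTFilter

namespace PPTFilter

open Matrix

/-! ### A Hermitian basis orthonormal for the trace form -/

section HermitianBasis

variable {κ : Type*} [Fintype κ] [DecidableEq κ]

/-- A basis of Hermitian matrices, orthonormal for the trace form. -/
noncomputable def hermitianBasis (a : κ × κ) : Matrix κ κ ℂ :=
  -- The weights are conjugate, their squares sum to 0 and twice their product is 1. Thus `(p, q)`
  -- and `(q, p)` give orthonormal Hermitian matrices, and `(p, p)` gives the matrix unit, without a
  -- case split.
  ((1 + Complex.I) / 2) • single a.1 a.2 1 + ((1 - Complex.I) / 2) • single a.2 a.1 1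

theorem isHermitian_hermitianBasis (a : κ × κ) : (hermitianBasis a).IsHermitian := by
  have h1 : star ((1 + Complex.I) / 2) = (1 - Complex.I) / 2 := by
    simp [sub_eq_add_neg]
  have h2 : star ((1 - Complex.I) / 2) = (1 + Complex.I) / 2 := by
    simp
  rw [IsHermitian, hermitianBasis, conjTranspose_add, conjTranspose_smul, conjTranspose_smul,
    h1, h2, conjTranspose_single, conjTranspose_single, star_one, add_comm]

theorem trace_mul_hermitianBasis (X : Matrix κ κ ℂ) (a : κ × κ) :
    (X * hermitianBasis a).trace =
      (1 + Complex.I) / 2 * X a.2 a.1 + (1 - Complex.I) / 2 * X a.1 a.2 := by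
  simp only [hermitianBasis, mul_add, mul_smul_comm, trace_add, trace_smul, trace_mul_single,
    smul_eq_mul, MulOpposite.op_one, one_smul]

theorem sum_trace_smul_hermitianBasis (X : Matrix κ κ ℂ) :
    ∑ a, (X * hermitianBasis a).trace • hermitianBasis a = X := by
  ext r s
  have h : ((1 + Complex.I) / 2) ^ 2 + ((1 - Complex.I) / 2) ^ 2 = 0 := by
    linear_combination (1 / 2 : ℂ) * Complex.I_sq
  have h' : 2 * ((1 + Complex.I) / 2) * ((1 - Complex.I) / 2) = 1 := by
    linear_combination (-1 / 2 : ℂ) * Complex.I_sq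
  simp only [trace_mul_hermitianBasis]
  simp only [Matrix.sum_apply, hermitianBasis, Matrix.smul_apply, Matrix.add_apply, single_apply, smul_eq_mul, Fintype.sum_prod_type, mul_add,
    Finset.sum_add_distrib]
  simp only [ite_and, mul_ite, mul_one, mul_zero, Finset.sum_ite_eq', Finset.sum_ite_irrel,
    Finset.sum_const_zero, Finset.mem_univ, if_true]
  linear_combination X s r * h + X r s * h'

theorem trace_hermitianBasis_mul (a b : κ × κ) :
    (hermitianBasis a * hermitianBasis b).trace = if a = b then 1 else 0 := by
  have h : ((1 + Complex.I) / 2) ^ 2 + ((1 - Complex.I) / 2) ^ 2 = 0 := by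
    linear_combination (1 / 2 : ℂ) * Complex.I_sq
  have h' : 2 * ((1 + Complex.I) / 2) * ((1 - Complex.I) / 2) = 1 := by
    linear_combination (-1 / 2 : ℂ) * Complex.I_sq
  rw [trace_mul_hermitianBasis]
  obtain ⟨p, q⟩ := a
  obtain ⟨r, s⟩ := b
  simp only [hermitianBasis, Matrix.add_apply, Matrix.smul_apply, single_apply, smul_eq_mul,
    Prod.mk.injEq, and_comm (a := q = s) (b := p = r), and_comm (a := q = r) (b := p = s)]
  generalize (if p = s ∧ q = r then (1 : ℂ) else 0) = x
  generalize (if p = r ∧ q = s then (1 : ℂ) else 0) = y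
  linear_combination x * h + y * h'

end HermitianBasis

/-! ### Operator Schmidt decomposition and the filter normal form -/

section Decomposition

variable {ι κ : Type*} [Fintype ι] [DecidableEq ι] [Fintype κ] [DecidableEq κ]

theorem ofReal_re_trace_mul {n : Type*} [Fintype n] {X Y : Matrix n n ℂ} (hX : X.IsHermitian)
    (hY : Y.IsHermitian) : (((X * Y).trace.re : ℝ) : ℂ) = (X * Y).trace := by
  refine Complex.conj_eq_iff_re.mp ?_
  rw [starRingEnd_apply, ← trace_conjTranspose, conjTranspose_mul, hX.eq, hY.eq, trace_mul_comm]

/-- An orthonormal basis of Hermitian matrices that is mapped by the dual of `G_A` to a family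
which is orthogonal for the trace form. -/
theorem exists_hermitian_orthonormal_diagonalizing {A : Matrix (ι × κ) (ι × κ) ℂ}
    (hA : A.IsHermitian) : ∃ F : κ × κ → Matrix κ κ ℂ, (∀ i, (F i).IsHermitian) ∧
      (∀ i j, i ≠ j → (F i * F j).trace = 0) ∧
      (∀ X, ∑ i, (X * F i).trace • F i = X) ∧
      ∀ i j, i ≠ j → (dualMapG A (F i) * dualMapG A (F j)).trace = 0 := by
  let H : κ × κ → Matrix κ κ ℂ := hermitianBasis
  have hH : ∀ a, (dualMapG A (H a)).IsHermitian := fun a =>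
    isHermitian_dualMapG hA (isHermitian_hermitianBasis a)
  -- Gram matrix of the images. Traces of products of Hermitian matrices are real, so the real
  -- spectral theorem applies; its orthogonal `U` preserves both Hermiticity and the bilinear trace
  -- form.
  let N : Matrix (κ × κ) (κ × κ) ℝ :=
    of fun a b => (dualMapG A (H a) * dualMapG A (H b)).trace.re
  have hN : N.IsHermitian := by
    ext a b
    simp only [N, conjTranspose_apply, of_apply, star_trivial]
    rw [trace_mul_comm]
  let U : Matrix (κ × κ) (κ × κ) ℝ := hN.eigenvectorUnitary
  have hU1 : Uᵀ * U = 1 := by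
    have h := Unitary.coe_star_mul_self hN.eigenvectorUnitary
    rwa [star_eq_conjTranspose, conjTranspose_eq_transpose_of_trivial] at h
  have hU2 : U * Uᵀ = 1 := mul_eq_one_comm.mp hU1
  have hdiag : Uᵀ * N * U = diagonal hN.eigenvalues := by
    have h := hN.conjStarAlgAut_star_eigenvectorUnitary
    rw [Unitary.conjStarAlgAut_star_apply, star_eq_conjTranspose,
      conjTranspose_eq_transpose_of_trivial] at h
    exact h
  let F : κ × κ → Matrix κ κ ℂ := fun j => ∑ a, (U a j : ℂ) • H a
  refine ⟨F, fun i => ?_, fun i j hij => ?_, fun X => ?_, fun i j hij => ?_⟩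
  · rw [IsHermitian, conjTranspose_sum]
    refine Finset.sum_congr rfl fun a _ => ?_
    rw [conjTranspose_smul, (isHermitian_hermitianBasis a).eq]
    simp [H]
  · have h : (F i * F j).trace = (((Uᵀ * U) i j : ℝ) : ℂ) := by
      simp only [F, H, Finset.sum_mul, Finset.mul_sum, trace_sum, smul_mul_smul_comm, trace_smul,
        trace_hermitianBasis_mul, smul_eq_mul, mul_ite, mul_one, mul_zero, Finset.sum_ite_eq',
        Finset.mem_univ, if_true, mul_apply, transpose_apply]
      push_cast
      rfl
    rw [h, hU1, one_apply_ne hij, Complex.ofReal_zero]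
  · have h : ∀ a b, ∑ i, (U a i : ℂ) * (U b i : ℂ) = if a = b then 1 else 0 := by
      intro a b
      have := congrFun (congrFun hU2 a) b
      rw [mul_apply, one_apply] at this
      have := congrArg (fun x : ℝ => (x : ℂ)) this
      simpa [apply_ite] using this
    calc ∑ i, (X * F i).trace • F i
        = ∑ i, ∑ a, ∑ b, ((U a i : ℂ) * (U b i : ℂ)) • ((X * H a).trace • H b) := by
          refine Finset.sum_congr rfl fun i _ => ?_
          simp only [F, Finset.mul_sum, mul_smul_comm, trace_sum, trace_smul, Finset.smul_sum,
            smul_smul, smul_eq_mul, Finset.sum_mul, Finset.sum_smul]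
          rw [Finset.sum_comm]
          refine Finset.sum_congr rfl fun a _ => Finset.sum_congr rfl fun b _ => ?_
          congr 1
          ring
      _ = ∑ a, ∑ b, (∑ i, (U a i : ℂ) * (U b i : ℂ)) • ((X * H a).trace • H b) := by
          simp only [Finset.sum_smul]
          rw [Finset.sum_comm]
          exact Finset.sum_congr rfl fun a _ => Finset.sum_comm
      _ = X := by
          simp only [h, ite_smul, one_smul, zero_smul, Finset.sum_ite_eq, Finset.mem_univ, if_true]
          exact sum_trace_smul_hermitianBasis X
  · have hNc : ∀ a b, (dualMapG A (H a) * dualMapG A (H b)).trace = (N a b : ℂ) := fun a b =>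
      (ofReal_re_trace_mul (hH a) (hH b)).symm
    have h : (dualMapG A (F i) * dualMapG A (F j)).trace = (((Uᵀ * N * U) i j : ℝ) : ℂ) := by
      simp only [F, map_sum, map_smul, Finset.sum_mul, Finset.mul_sum, trace_sum,
        smul_mul_smul_comm, trace_smul, hNc, smul_eq_mul, mul_apply, transpose_apply]
      push_cast
      refine Finset.sum_congr rfl fun b _ => Finset.sum_congr rfl fun a _ => ?_
      ring
    rw [h, hdiag, diagonal_apply_ne _ hij, Complex.ofReal_zero]

/-- On `C ⊗ D` this is the expansion of `D` in the family `F`. -/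
theorem sum_dualMapG_kronecker {σ : Type*} [Fintype σ] {F : σ → Matrix κ κ ℂ}
    (hF : ∀ X, ∑ i, (X * F i).trace • F i = X) (A : Matrix (ι × κ) (ι × κ) ℂ) :
    ∑ i, dualMapG A (F i) ⊗ₖ F i = A := by
  induction A using kronecker_induction with
  | zero => simp [dualMapG_zero]
  | add A B hA hB => simp [dualMapG_add, add_kronecker, Finset.sum_add_distrib, hA, hB]
  | kron C D =>
    conv_rhs => rw [← hF D]
    ext p q
    simp [dualMapG_kronecker, Matrix.sum_apply, kroneckerMap_apply, Finset.mul_sum,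
      mul_left_comm, mul_assoc]

theorem IsHermitian.eq_zero_of_trace_mul_self {n : Type*} [Fintype n] {X : Matrix n n ℂ}
    (hX : X.IsHermitian) (h : (X * X).trace = 0) : X = 0 := by
  rw [← trace_conjTranspose_mul_self_eq_zero_iff, hX.eq, h]

/-- A Hermitian matrix with vanishing marginals is an orthogonal sum of Kronecker products of
traceless matrices. -/
theorem exists_traceless_decomposition {A : Matrix (ι × κ) (ι × κ) ℂ} (hA : A.IsHermitian)
    (h1 : mapG A 1 = 0) (h2 : dualMapG A 1 = 0) :
    ∃ (s : ℕ) (E : Fin s → Matrix ι ι ℂ) (F : Fin s → Matrix κ κ ℂ), A = ∑ i, E i ⊗ₖ F i ∧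
      (∀ i, (E i).trace = 0 ∧ (F i).trace = 0) ∧
      ∀ i j, i ≠ j → (E i * E j).trace = 0 ∧ (F i * F j).trace = 0 := by
  classical
  obtain ⟨F, hF, horth, hcomp, hdual⟩ := exists_hermitian_orthonormal_diagonalizing hA
  let E : κ × κ → Matrix ι ι ℂ := fun i => dualMapG A (F i)
  have hE : ∀ i, (E i).trace = 0 := fun i => by
    have h := trace_mapG_mul A 1 (F i)
    rw [h1, Matrix.zero_mul, trace_zero, Matrix.mul_one] at h
    exact h.symm
  -- Pairing `0 = G_A^*(1) = ∑ tr(F i) E i` with `E j` leaves `tr(F j) tr(E j ²)`, and the second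
  -- factor is nonzero for Hermitian `E j ≠ 0`.
  have hFtr : ∀ j, E j ≠ 0 → (F j).trace = 0 := fun j hj => by
    have h : ∑ i, (F i).trace • E i = 0 := by
      rw [← h2]
      conv_rhs => rw [← hcomp 1]
      simp [E]
    have h' := congrArg (fun M => (M * E j).trace) h
    simp only [Finset.sum_mul, smul_mul_assoc, trace_sum, trace_smul, Matrix.zero_mul, trace_zero,
      smul_eq_mul] at h'
    rw [Finset.sum_eq_single j (fun i _ hij => by rw [hdual i j hij, mul_zero])
      (fun h => absurd (Finset.mem_univ j) h)] at h'
    refine (mul_eq_zero.mp h').resolve_right fun h0 => hj ?_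
    exact IsHermitian.eq_zero_of_trace_mul_self (isHermitian_dualMapG hA (hF j)) h0
  -- Where `E i = 0` the trace of `F i` is not controlled, but the term vanishes, so `F i` may be
  -- replaced by 0.
  let F' : κ × κ → Matrix κ κ ℂ := fun i => if E i = 0 then 0 else F i
  let e := (Fintype.equivFin (κ × κ)).symm
  refine ⟨_, fun i => E (e i), fun i => F' (e i), ?_, fun i => ⟨hE _, ?_⟩, fun i j hij => ⟨?_, ?_⟩⟩
  · rw [Equiv.sum_comp e fun i => E i ⊗ₖ F' i]
    conv_lhs => rw [← sum_dualMapG_kronecker hcomp A]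
    refine Finset.sum_congr rfl fun i _ => ?_
    by_cases h : E i = 0
    · simp only [F', h, if_true, kronecker_zero]
      change E i ⊗ₖ F i = 0
      rw [h, zero_kronecker]
    · simp only [F', h, if_false, E]
  · by_cases h : E (e i) = 0
    · simp [F', h]
    · simp [F', h, hFtr _ h]
  · exact hdual _ _ (e.injective.ne hij)
  · have := horth _ _ (e.injective.ne hij)
    by_cases h : E (e i) = 0 <;> by_cases h' : E (e j) = 0 <;> simp [F', h, h', this]

theorem one_div_sqrt_mul_mul_one_div_sqrt {x y : ℝ} :
    ((1 / √x : ℝ) : ℂ) * x * ((1 / √y : ℝ) : ℂ) = ((√x / √y : ℝ) : ℂ) := by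
  rw [← Complex.ofReal_mul, ← Complex.ofReal_mul, one_div, inv_mul_eq_div, Real.div_sqrt,
    mul_one_div]

/-- Orthogonality to the leading identity multiples makes all other factors traceless, so the
marginals see only the leading term. -/
theorem HasFilterNormalForm.hasBalancedForm [Nonempty ι] [Nonempty κ]
    {A : Matrix (ι × κ) (ι × κ) ℂ} (h : HasFilterNormalForm A) : HasBalancedForm A := by
  obtain ⟨R, S, hR, hS, s, C, D, hA, hC, hD, horth⟩ := h
  have hι : (0 : ℝ) < Fintype.card ι := by exact_mod_cast Fintype.card_pos
  have hκ : (0 : ℝ) < Fintype.card κ := by exact_mod_cast Fintype.card_pos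
  have hιs := Real.sqrt_pos.mpr hι
  have hκs := Real.sqrt_pos.mpr hκ
  have hιc : ((1 / √(Fintype.card ι) : ℝ) : ℂ) ≠ 0 := by
    exact_mod_cast (by positivity : (1 / √(Fintype.card ι : ℝ)) ≠ 0)
  have hκc : ((1 / √(Fintype.card κ) : ℝ) : ℂ) ≠ 0 := by
    exact_mod_cast (by positivity : (1 / √(Fintype.card κ : ℝ)) ≠ 0)
  have hCtr : ∀ j, j ≠ 0 → (C j).trace = 0 := fun j hj => by
    have h := (horth 0 j hj.symm).1
    rw [hC, smul_mul_assoc, Matrix.one_mul, trace_smul, smul_eq_mul] at h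
    exact (mul_eq_zero.mp h).resolve_left hιc
  have hDtr : ∀ j, j ≠ 0 → (D j).trace = 0 := fun j hj => by
    have h := (horth 0 j hj.symm).2
    rw [hD, smul_mul_assoc, Matrix.one_mul, trace_smul, smul_eq_mul] at h
    exact (mul_eq_zero.mp h).resolve_left hκc
  refine ⟨R, S, hR, hS, ?_, ?_⟩
  · rw [hA, mapG_sum_kronecker, Finset.sum_eq_single 0
      (fun j _ hj => by rw [Matrix.mul_one, hCtr j hj, zero_smul])
      (fun h => absurd (Finset.mem_univ _) h), hC, hD, Matrix.mul_one, trace_smul, trace_one,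
      smul_smul, smul_eq_mul, ← one_div_sqrt_mul_mul_one_div_sqrt]
    push_cast
    rfl
  · rw [hA, dualMapG_sum_kronecker, Finset.sum_eq_single 0
      (fun j _ hj => by rw [Matrix.mul_one, hDtr j hj, zero_smul])
      (fun h => absurd (Finset.mem_univ _) h), hC, hD, Matrix.mul_one, trace_smul, trace_one,
      smul_smul, smul_eq_mul, ← one_div_sqrt_mul_mul_one_div_sqrt]
    push_cast
    rfl

/-- The balanced constants are exactly the marginals of `E₀ ⊗ F₀`; subtracting it leaves a Hermitian
matrix with zero marginals. -/
theorem HasBalancedForm.hasFilterNormalForm [Nonempty ι] [Nonempty κ]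
    {A : Matrix (ι × κ) (ι × κ) ℂ} (hA : A.IsHermitian) (h : HasBalancedForm A) :
    HasFilterNormalForm A := by
  obtain ⟨R, S, hR, hS, h1, h2⟩ := h
  have hA' : ((R ⊗ₖ S) * A * (R ⊗ₖ S)ᴴ).IsHermitian := isHermitian_mul_mul_conjTranspose _ hA
  refine ⟨R, S, hR, hS, ?_⟩
  generalize (R ⊗ₖ S) * A * (R ⊗ₖ S)ᴴ = A' at *
  have hι : (0 : ℝ) < Fintype.card ι := by exact_mod_cast Fintype.card_pos
  have hκ : (0 : ℝ) < Fintype.card κ := by exact_mod_cast Fintype.card_pos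
  have hιs := Real.sqrt_pos.mpr hι
  have hκs := Real.sqrt_pos.mpr hκ
  let E₀ : Matrix ι ι ℂ := ((1 / √(Fintype.card ι) : ℝ) : ℂ) • 1
  let F₀ : Matrix κ κ ℂ := ((1 / √(Fintype.card κ) : ℝ) : ℂ) • 1
  have hEF : (E₀ ⊗ₖ F₀).IsHermitian := by
    rw [IsHermitian, conjTranspose_kronecker]
    simp [E₀, F₀, conjTranspose_smul]
  have h1' : mapG (A' - E₀ ⊗ₖ F₀) 1 = 0 := by
    rw [mapG_sub, LinearMap.sub_apply, h1, mapG_kronecker, sub_eq_zero, Matrix.mul_one, trace_smul,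
      trace_one, smul_smul, smul_eq_mul, ← one_div_sqrt_mul_mul_one_div_sqrt]
    push_cast
    rfl
  have h2' : dualMapG (A' - E₀ ⊗ₖ F₀) 1 = 0 := by
    rw [dualMapG_sub, LinearMap.sub_apply, h2, dualMapG_kronecker, sub_eq_zero, Matrix.mul_one,
      trace_smul, trace_one, smul_smul, smul_eq_mul, ← one_div_sqrt_mul_mul_one_div_sqrt]
    push_cast
    rfl
  obtain ⟨s, E, F, hEFsum, htr, horth⟩ := exists_traceless_decomposition (hA'.sub hEF) h1' h2'
  refine ⟨s, Fin.cons E₀ E, Fin.cons F₀ F, ?_, rfl, rfl, ?_⟩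
  · rw [Fin.sum_univ_succ]
    simp only [Fin.cons_zero, Fin.cons_succ]
    rw [← hEFsum]
    abel
  · intro i j
    refine Fin.cases ?_ (fun i => ?_) i <;> refine Fin.cases ?_ (fun j => ?_) j
    · exact fun h => absurd rfl h
    · intro _
      simp [E₀, F₀, htr]
    · intro _
      simp [E₀, F₀, htr]
    · intro h
      simpa using horth i j fun e => h (congrArg Fin.succ e)

theorem hasFilterNormalForm_iff_hasBalancedForm [Nonempty ι] [Nonempty κ]
    {A : Matrix (ι × κ) (ι × κ) ℂ} (hA : A.IsHermitian) :
    HasFilterNormalForm A ↔ HasBalancedForm A :=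
  ⟨HasFilterNormalForm.hasBalancedForm, HasBalancedForm.hasFilterNormalForm hA⟩

end Decomposition

end PPTFilter

/-! ### Assembly of the equivalences -/

theorem mainTheorem5 (k m n : ℕ) (hk : 0 < k) (hm : 0 < m)
    (C : Fin n → Matrix (Fin k) (Fin k) ℂ) (D : Fin n → Matrix (Fin m) (Fin m) ℂ)
    (B : Matrix (Fin k × Fin m) (Fin k × Fin m) ℂ)
    (hB : B = ∑ i, C i ⊗ₖ D i) (hPPT : PPTFilter.IsPPT B) :
    PPTFilter.IsPPT (PPTFilter.tildeMatrix C D) ∧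
    (PPTFilter.HasFilterNormalForm B ↔
      PPTFilter.HasFilterNormalForm (PPTFilter.tildeMatrix C D)) ∧
    (PPTFilter.HasFilterNormalForm B ↔
      PPTFilter.EquivalentToDoublyStochastic
        (PPTFilter.mapGTranspose (PPTFilter.tildeMatrix C D))) := by
  subst hB
  have : NeZero k := ⟨hk.ne'⟩
  have : NeZero m := ⟨hm.ne'⟩
  have hT := PPTFilter.isPPT_tildeMatrix C D hPPT
  -- The balanced form of `B̃` is the common middle term of both equivalences.
  have hiff : PPTFilter.HasFilterNormalForm (∑ i, C i ⊗ₖ D i) ↔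
      PPTFilter.HasBalancedForm (PPTFilter.tildeMatrix C D) := by
    rw [PPTFilter.hasFilterNormalForm_iff_hasBalancedForm hPPT.1.isHermitian,
      PPTFilter.hasBalancedForm_iff_isScalable, PPTFilter.hasBalancedForm_iff_isScalable,
      PPTFilter.isScalable_tildeMatrix_iff C D hk hm]
  refine ⟨hT, ?_, ?_⟩
  · rw [hiff, PPTFilter.hasFilterNormalForm_iff_hasBalancedForm hT.1.isHermitian]
  · rw [hiff, PPTFilter.equivalentToDoublyStochastic_mapGTranspose_iff hT.1]
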